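/- Let $(X,h)$ be a $C^3$ Riemannian $n$-manifold, i.e. an $n$-manifold (without boundary, not necessarily connected) with a $C^4$ atlas and a Riemannian metric $h$ of class $C^3$. Let $Z\subset X$ be a closed subset whose Hausdorff dimension, with respect to the Riemannian distance of $h$, satisfies $\dim_{\mathcal H} Z< n-1$ (with the convention $\dim_{\mathcal H}\varnothing=0$), and let $Y=X-Z$. By a Killing field on an open set $U\subset X$ we mean a vector field $\xi$ of class $C^1$ on $U$ with $\mathcal L_\xi h=0$ on $U$, where $$(\mathcal L_\xi h)(V,W)=\xi\big(h(V,W)\big)-h([\xi,V],W)-h(V,[\xi,W])$$ for all locally defined $C^1$ vector fields $V,W$. If $\xi$ is a Killing field on $Y$, then there is a Killing field $\hat\xi$ on all of $X$ with $\hat\xi=\xi$ on $Y$. -/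

import Mathlib

open Set Bundle
open scoped Manifold ContDiff ENNReal

noncomputable section

/-- The Lie derivative of the Riemannian metric `h = ⟪·, ·⟫` along the vector field `ξ`, evaluated on
the vector fields `V`, `W` at the point `x`:
`(L_ξ h)(V, W) = ξ (h(V, W)) - h([ξ, V], W) - h(V, [ξ, W])`. -/
def lieDerivMetric {E : Type*} [NormedAddCommGroup E] [NormedSpace ℝ E]
    {H : Type*} [TopologicalSpace H] (I : ModelWithCorners ℝ E H)
    {M : Type*} [TopologicalSpace M] [ChartedSpace H M]
    [RiemannianBundle (fun x : M ↦ TangentSpace I x)]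
    (ξ V W : Π x : M, TangentSpace I x) (x : M) : ℝ :=
  mvfderiv I (fun y : M ↦ inner ℝ (V y) (W y)) x (ξ x)
    - inner ℝ (VectorField.mlieBracket I ξ V x) (W x)
    - inner ℝ (V x) (VectorField.mlieBracket I ξ W x)

/-- `ξ` is a Killing field on the open set `s` of the Riemannian manifold `M`: it is a vector field
of class `C^1` on `s` along which the Lie derivative of the metric vanishes, i.e.
`(L_ξ h)(V, W) = 0` at every point `x` of `s`, for all vector fields `V`, `W` of class `C^1` near
`x`. The values of `ξ` outside `s` are irrelevant. -/
def IsKillingFieldOn {E : Type*} [NormedAddCommGroup E] [NormedSpace ℝ E]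
    {H : Type*} [TopologicalSpace H] (I : ModelWithCorners ℝ E H)
    {M : Type*} [TopologicalSpace M] [ChartedSpace H M] [IsManifold I 1 M]
    [RiemannianBundle (fun x : M ↦ TangentSpace I x)]
    (ξ : Π x : M, TangentSpace I x) (s : Set M) : Prop :=
  ContMDiffOn I I.tangent 1 (fun x ↦ (⟨x, ξ x⟩ : TangentBundle I M)) s ∧
    ∀ x ∈ s, ∀ V W : Π y : M, TangentSpace I y,
      ContMDiffAt I I.tangent 1 (fun y ↦ (⟨y, V y⟩ : TangentBundle I M)) x →
      ContMDiffAt I I.tangent 1 (fun y ↦ (⟨y, W y⟩ : TangentBundle I M)) x →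
      lieDerivMetric I ξ V W x = 0

end

/-! A Killing field satisfies a prolonged linear system of finite type. Lower the index: for the
one-form `η = h(ξ, ·)` in a chart, the Killing equation says that the symmetrized derivative of `η`
is a linear function `Q x (η x)` with `C^1` coefficients. Mixed second derivatives commute, so the
polarization behind the Koszul formula recovers all of `D²η` from the derivative of the symmetrized
`Dη`. Hence the 1-jet `(η, Dη)` satisfies `‖f'‖ ≤ C ‖f‖`. That a `C^1` form `η` really is `C^2` is
obtained by mollification (`contDiffOn_two_of_symmetrizeBilin`).

Since the removed set has codimension larger than one, its radial projection to a hyperplane has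
dense complement, so from any point outside it a dense set of points is visible along segments
(`dense_setOf_disjoint_segment`). Grönwall's inequality along such segments bounds the jet, and the
mean value inequality then makes it Lipschitz for the ambient distance. The jet therefore extends by
continuity, and a Taylor estimate shows that its second component is still the derivative of the
first (`exists_contDiffOn_extension`). The Killing equation persists by density.

Charts are locally Lipschitz for the Riemannian distance, so they do not raise Hausdorff dimension
and the problem is local. Local extensions agree off `Z`, which has dense complement, and therefore
glue. -/

/-! ### Regularity of one-forms with `C^1` symmetrized derivative -/

section Regularity

set_option maxSynthPendingDepth 3

open MeasureTheory Filter Topology ContinuousLinearMap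
open scoped Convolution

set_option synthInstance.maxHeartbeats 100000

variable {E : Type*} [NormedAddCommGroup E] [NormedSpace ℝ E]
variable {F : Type*} [NormedAddCommGroup F] [NormedSpace ℝ F]

/-- The symmetrization `A ↦ (v ↦ w ↦ A v w + A w v)` of bilinear forms. -/
noncomputable def symmetrizeBilin (E : Type*) [NormedAddCommGroup E] [NormedSpace ℝ E] :
    (E →L[ℝ] E →L[ℝ] ℝ) →L[ℝ] (E →L[ℝ] E →L[ℝ] ℝ) :=
  ContinuousLinearMap.id ℝ _ +
    ((flipₗᵢ ℝ E E ℝ).toContinuousLinearEquiv : (E →L[ℝ] E →L[ℝ] ℝ) →L[ℝ] (E →L[ℝ] E →L[ℝ] ℝ))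

@[simp]
lemma symmetrizeBilin_apply (A : E →L[ℝ] E →L[ℝ] ℝ) (v w : E) :
    symmetrizeBilin E A v w = A v w + A w v := by
  simp [symmetrizeBilin]

/-- The trilinear form `(u, v, w) ↦ (A u v w + A v u w - A w u v) / 2`. It recovers a trilinear form
which is symmetric in its first two arguments from its symmetrization in the last two ones. -/
noncomputable def polarizeTrilin (E : Type*) [NormedAddCommGroup E] [NormedSpace ℝ E] :
    (E →L[ℝ] E →L[ℝ] E →L[ℝ] ℝ) →L[ℝ] (E →L[ℝ] E →L[ℝ] E →L[ℝ] ℝ) :=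
  let fl : (E →L[ℝ] E →L[ℝ] E →L[ℝ] ℝ) →L[ℝ] (E →L[ℝ] E →L[ℝ] E →L[ℝ] ℝ) :=
    ((flipₗᵢ ℝ E E (E →L[ℝ] ℝ)).toContinuousLinearEquiv :
      (E →L[ℝ] E →L[ℝ] E →L[ℝ] ℝ) →L[ℝ] (E →L[ℝ] E →L[ℝ] E →L[ℝ] ℝ))
  let fl' : (E →L[ℝ] E →L[ℝ] ℝ) →L[ℝ] (E →L[ℝ] E →L[ℝ] ℝ) :=
    ((flipₗᵢ ℝ E E ℝ).toContinuousLinearEquiv :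
      (E →L[ℝ] E →L[ℝ] ℝ) →L[ℝ] (E →L[ℝ] E →L[ℝ] ℝ))
  (2⁻¹ : ℝ) • (ContinuousLinearMap.id ℝ _ + fl - (compL ℝ E _ _ fl') ∘L fl)

@[simp]
lemma polarizeTrilin_apply (A : E →L[ℝ] E →L[ℝ] E →L[ℝ] ℝ) (u v w : E) :
    polarizeTrilin E A u v w = 2⁻¹ * (A u v w + A v u w - A w u v) :=
  rfl

lemma fderiv_symmetrizeBilin_comp {A : E → E →L[ℝ] E →L[ℝ] ℝ} {x : E}
    (hA : DifferentiableAt ℝ A x) :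
    fderiv ℝ (fun y ↦ symmetrizeBilin E (A y)) x = symmetrizeBilin E ∘L fderiv ℝ A x :=
  ((symmetrizeBilin E).hasFDerivAt.comp x hA.hasFDerivAt).fderiv

/-- The second derivative of a one-form is determined by the derivative of its symmetrized first
derivative. -/
lemma fderiv_fderiv_eq_polarizeTrilin {η : E → E →L[ℝ] ℝ} {x : E} (hη : ContDiffAt ℝ 2 η x) :
    fderiv ℝ (fderiv ℝ η) x =
      polarizeTrilin E (fderiv ℝ (fun y ↦ symmetrizeBilin E (fderiv ℝ η y)) x) := by
  have hd : DifferentiableAt ℝ (fderiv ℝ η) x :=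
    (hη.fderiv_right (m := 1) (by norm_num)).differentiableAt (by norm_num)
  have hs : IsSymmSndFDerivAt ℝ η x := hη.isSymmSndFDerivAt (by simp)
  rw [fderiv_symmetrizeBilin_comp hd]
  ext u v w
  simp only [polarizeTrilin_apply, coe_comp, Function.comp_apply, symmetrizeBilin_apply]
  -- Of the six second derivatives in the alternating sum, four cancel by symmetry and two add up to
  -- twice the term sought.
  rw [hs.eq u v, hs.eq u w, hs.eq w v]
  ring

/-- A sequence of bump functions around `0` whose supports shrink to `0`. -/
noncomputable def shrinkingBump (E : Type*) [NormedAddCommGroup E] (n : ℕ) :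
    ContDiffBump (0 : E) where
  rIn := 1 / ((n : ℝ) + 1) / 2
  rOut := 1 / ((n : ℝ) + 1)
  rIn_pos := by positivity
  rIn_lt_rOut := half_lt_self (by positivity)

omit [NormedSpace ℝ E] in
lemma tendsto_shrinkingBump_rOut :
    Tendsto (fun n ↦ (shrinkingBump E n).rOut) atTop (𝓝 0) :=
  tendsto_one_div_add_atTop_nhds_zero_nat

variable [FiniteDimensional ℝ E] [MeasurableSpace E] [BorelSpace E] {μ : Measure E}
  [μ.IsAddHaarMeasure]

lemma tendstoUniformly_normed_convolution [CompleteSpace F] {g : E → F} (hg : Continuous g)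
    (hc : HasCompactSupport g) :
    TendstoUniformly
      (fun n ↦ ((shrinkingBump E n).normed μ ⋆[lsmul ℝ ℝ, μ] g : E → F)) g atTop := by
  have hu : UniformContinuous g := hc.uniformContinuous_of_continuous hg
  rw [Metric.tendstoUniformly_iff]
  intro ε hε
  obtain ⟨δ, hδ, h⟩ := Metric.uniformContinuous_iff.1 hu (ε / 2) (half_pos hε)
  filter_upwards [(tendsto_shrinkingBump_rOut (E := E)).eventually_lt_const hδ] with n hn x
  rw [dist_comm]
  refine (ContDiffBump.dist_normed_convolution_le hg.aestronglyMeasurable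
    fun y hy ↦ (h ((Metric.mem_ball.1 hy).trans hn)).le).trans_lt (half_lt_self hε)

lemma hasFDerivAt_normed_convolution {g : E → F} (hg : ContDiff ℝ 1 g)
    (hc : HasCompactSupport g) (φ : ContDiffBump (0 : E)) (x : E) :
    HasFDerivAt (φ.normed μ ⋆[lsmul ℝ ℝ, μ] g : E → F)
      ((φ.normed μ ⋆[lsmul ℝ ℝ, μ] fderiv ℝ g : E → E →L[ℝ] F) x) x := by
  have h := hc.hasFDerivAt_convolution_right (μ := μ) (lsmul ℝ ℝ)
    (φ.continuous_normed (μ := μ)).locallyIntegrable hg x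
  have h' : ((lsmul ℝ ℝ : ℝ →L[ℝ] F →L[ℝ] F).precompR E) =
      (lsmul ℝ ℝ : ℝ →L[ℝ] (E →L[ℝ] F) →L[ℝ] (E →L[ℝ] F)) := by
    ext; simp [precompR]
  rwa [h'] at h

/-- Mollification commutes with constant linear maps, so the symmetrized derivative of a mollified
form is the mollification of the symmetrized derivative. -/
lemma clm_normed_convolution {G : Type*} [NormedAddCommGroup G] [NormedSpace ℝ G]
    [CompleteSpace F] [CompleteSpace G]
    {g : E → F} (hg : Continuous g) (Φ : F →L[ℝ] G) (φ : ContDiffBump (0 : E)) (x : E) :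
    (φ.normed μ ⋆[lsmul ℝ ℝ, μ] (fun y ↦ Φ (g y)) : E → G) x =
      Φ ((φ.normed μ ⋆[lsmul ℝ ℝ, μ] g : E → F) x) := by
  have hi : ConvolutionExistsAt (φ.normed μ) g x (lsmul ℝ ℝ) μ :=
    φ.hasCompactSupport_normed.convolutionExists_left (lsmul ℝ ℝ) φ.continuous_normed
      hg.locallyIntegrable x
  rw [convolution, convolution, ← Φ.integral_comp_comm hi.integrable]
  simp

omit [MeasurableSpace E] [BorelSpace E] in
/-- A compactly supported `C^1` one-form whose symmetrized derivative is `C^1` is `C^2`. -/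
lemma contDiff_two_of_symmetrizeBilin_of_hasCompactSupport {η : E → E →L[ℝ] ℝ}
    (hη : ContDiff ℝ 1 η) (hc : HasCompactSupport η)
    (hS : ContDiff ℝ 1 fun x ↦ symmetrizeBilin E (fderiv ℝ η x)) : ContDiff ℝ 2 η := by
  borelize E
  let μ : Measure E := Measure.addHaar
  set S := fun x ↦ symmetrizeBilin E (fderiv ℝ η x) with hSdef
  have hcd : HasCompactSupport (fderiv ℝ η) := hc.fderiv ℝ
  have hcS : HasCompactSupport S := hcd.comp_left (map_zero (symmetrizeBilin E))
  have hcont : Continuous (fderiv ℝ η) := hη.continuous_fderiv one_ne_zero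
  set φ : ℕ → ContDiffBump (0 : E) := shrinkingBump E
  -- The mollified forms are smooth enough for the polarization formula. It writes their second
  -- derivatives through mollifications of `fderiv ℝ S`, which converge uniformly although `η` is
  -- not yet known to be `C^2`.
  let ηs : ℕ → E → E →L[ℝ] ℝ := fun n ↦ (φ n).normed μ ⋆[lsmul ℝ ℝ, μ] η
  have hs : ∀ n, ContDiff ℝ 2 (ηs n) := fun n ↦
    (φ n).hasCompactSupport_normed.contDiff_convolution_left (n := 2) (lsmul ℝ ℝ)
      (φ n).contDiff_normed hη.continuous.locallyIntegrable
  have hfd : ∀ n, fderiv ℝ (ηs n) = (φ n).normed μ ⋆[lsmul ℝ ℝ, μ] fderiv ℝ η := fun n ↦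
    funext fun x ↦ (hasFDerivAt_normed_convolution hη hc (φ n) x).fderiv
  have hsym : ∀ n, (fun x ↦ symmetrizeBilin E (fderiv ℝ (ηs n) x)) =
      (φ n).normed μ ⋆[lsmul ℝ ℝ, μ] S := fun n ↦ funext fun x ↦ by
    rw [hfd n, hSdef, clm_normed_convolution hcont]
  have hsnd : ∀ n x, HasFDerivAt (fderiv ℝ (ηs n)) (polarizeTrilin E
      (((φ n).normed μ ⋆[lsmul ℝ ℝ, μ] fderiv ℝ S : E → E →L[ℝ] E →L[ℝ] E →L[ℝ] ℝ) x)) x := by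
    intro n x
    have h1 := fderiv_fderiv_eq_polarizeTrilin (hs n).contDiffAt (x := x)
    rw [hsym n, (hasFDerivAt_normed_convolution hS hcS (φ n) x).fderiv] at h1
    rw [← h1]
    exact (((hs n).fderiv_right (m := 1) (by norm_num)).differentiable
      (by norm_num) x).hasFDerivAt
  have hlim : TendstoUniformly (fun n x ↦ polarizeTrilin E
      (((φ n).normed μ ⋆[lsmul ℝ ℝ, μ] fderiv ℝ S : E → E →L[ℝ] E →L[ℝ] E →L[ℝ] ℝ) x))
      (fun x ↦ polarizeTrilin E (fderiv ℝ S x)) atTop :=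
    (polarizeTrilin E).uniformContinuous.comp_tendstoUniformly
      (tendstoUniformly_normed_convolution (hS.continuous_fderiv one_ne_zero) (hcS.fderiv ℝ))
  have hder : ∀ x, HasFDerivAt (fderiv ℝ η) (polarizeTrilin E (fderiv ℝ S x)) x := fun x ↦
    hasFDerivAt_of_tendstoLocallyUniformlyOn isOpen_univ
      hlim.tendstoLocallyUniformly.tendstoLocallyUniformlyOn (fun n x _ ↦ hsnd n x)
      (fun x _ ↦ by
        simp_rw [hfd]
        exact (tendstoUniformly_normed_convolution hcont hcd).tendsto_at x) (mem_univ x)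
  have h1 : ContDiff ℝ 1 (fderiv ℝ η) := by
    rw [contDiff_one_iff_fderiv]
    refine ⟨fun x ↦ (hder x).differentiableAt, ?_⟩
    rw [funext fun x ↦ (hder x).fderiv]
    exact (polarizeTrilin E).continuous.comp (hS.continuous_fderiv one_ne_zero)
  have h2 : (2 : ℕ∞ω) = 1 + 1 := by norm_num
  rw [h2, contDiff_succ_iff_fderiv]
  exact ⟨hη.differentiable one_ne_zero, by simp, h1⟩

omit [MeasurableSpace E] [BorelSpace E] in
/-- A `C^1` one-form whose symmetrized derivative is `C^1` is `C^2`. -/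
lemma contDiffOn_two_of_symmetrizeBilin {η : E → E →L[ℝ] ℝ} {U : Set E} (hU : IsOpen U)
    (hη : ContDiffOn ℝ 1 η U)
    (hS : ContDiffOn ℝ 1 (fun x ↦ symmetrizeBilin E (fderiv ℝ η x)) U) : ContDiffOn ℝ 2 η U := by
  intro x hx
  obtain ⟨r, hr, hrU⟩ := Metric.nhds_basis_closedBall.mem_iff.1 (hU.mem_nhds hx)
  let χ : ContDiffBump x := ⟨r / 2, r, half_pos hr, half_lt_self hr⟩
  have hχU : tsupport χ ⊆ U := by rw [χ.tsupport_eq]; exact hrU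
  let η' : E → E →L[ℝ] ℝ := fun y ↦ χ y • η y
  have hzero : ∀ y, y ∉ U → η' =ᶠ[𝓝 y] 0 := fun y hy ↦ by
    filter_upwards [(notMem_tsupport_iff_eventuallyEq.1 fun h ↦ hy (hχU h) : χ =ᶠ[𝓝 y] 0)]
      with z hz
    simp [η', hz]
  have hη' : ContDiff ℝ 1 η' := contDiff_iff_contDiffAt.2 fun y ↦ by
    by_cases hy : y ∈ U
    · exact χ.contDiff.contDiffAt.smul (hη.contDiffAt (hU.mem_nhds hy))
    · exact (contDiffAt_const (c := 0)).congr_of_eventuallyEq (hzero y hy)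
  have hS' : ContDiff ℝ 1 fun y ↦ symmetrizeBilin E (fderiv ℝ η' y) :=
    contDiff_iff_contDiffAt.2 fun y ↦ by
    by_cases hy : y ∈ U
    -- By the Leibniz rule the cutoff adds only a term of order zero in `η`, which is `C^1`.
    · have heq : (fun z ↦ symmetrizeBilin E (fderiv ℝ η' z)) =ᶠ[𝓝 y] fun z ↦
          χ z • symmetrizeBilin E (fderiv ℝ η z) +
            symmetrizeBilin E ((fderiv ℝ χ z).smulRight (η z)) := by
        filter_upwards [hU.mem_nhds hy] with z hz
        rw [fderiv_fun_smul (χ.contDiff.differentiable (n := 1) one_ne_zero z)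
          ((hη.contDiffAt (hU.mem_nhds hz)).differentiableAt one_ne_zero), map_add, map_smul]
      refine ContDiffAt.congr_of_eventuallyEq ?_ heq
      refine (χ.contDiff.contDiffAt.smul (hS.contDiffAt (hU.mem_nhds hy))).add
        ((symmetrizeBilin E).contDiff.contDiffAt.comp y (ContDiffAt.smulRight ?_
          (hη.contDiffAt (hU.mem_nhds hy))))
      exact (χ.contDiff (n := 2)).contDiffAt.fderiv_right (by norm_num)
    · refine (contDiffAt_const (c := 0)).congr_of_eventuallyEq ?_
      filter_upwards [(hzero y hy).eventuallyEq_nhds] with z hz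
      rw [hz.fderiv_eq]
      simp
  have hc : HasCompactSupport η' := χ.hasCompactSupport.smul_right
  refine ((contDiff_two_of_symmetrizeBilin_of_hasCompactSupport hη' hc
    hS').contDiffAt.congr_of_eventuallyEq ?_).contDiffWithinAt
  filter_upwards [χ.eventuallyEq_one] with y hy
  simp [η', hy]

end Regularity

/-! ### Visibility across sets of codimension larger than one -/

section Visibility

open Filter Topology Module
open scoped RealInnerProductSpace

variable {E : Type*} [NormedAddCommGroup E] [InnerProductSpace ℝ E] [FiniteDimensional ℝ E]

/-- If `K` has Hausdorff codimension larger than one and `p ∉ K`, then almost every point can be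
seen from `p` in the complement of `K`. -/
lemma dense_setOf_disjoint_segment {K : Set E} (hK : dimH K + 1 < finrank ℝ E) {p : E}
    (hp : p ∉ K) : Dense {q : E | Disjoint (segment ℝ p q) K} := by
  intro q₀
  by_cases hq₀ : q₀ = p
  · apply subset_closure
    simpa [hq₀] using hp
  set v : E := q₀ - p with hv
  have hv0 : v ≠ 0 := sub_ne_zero.2 hq₀
  have hvv : (0 : ℝ) < ⟪v, v⟫ := real_inner_self_pos.2 hv0
  let P : E →L[ℝ] (ℝ ∙ v)ᗮ := (ℝ ∙ v)ᗮ.orthogonalProjectionOnto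
  let s : Set E := {x | 0 < ⟪v, x - p⟫}
  -- Central projection from `p` onto the hyperplane through `q₀` orthogonal to `v`, in the
  -- coordinate `w` of the point `p + v + w`. It is smooth on the half-space `s`, and a `w` outside
  -- the image of `K` gives a point visible from `p`; then let `w` tend to `0`.
  let g : E → (ℝ ∙ v)ᗮ := fun x ↦ (⟪v, v⟫ / ⟪v, x - p⟫) • P (x - p)
  have hs : Convex ℝ s := by
    have : s = {x | ⟪v, p⟫ < innerSL ℝ v x} := by
      ext x; simp [s, inner_sub_right]
    rw [this]
    exact convex_halfSpace_gt (innerSL ℝ v).isLinear _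
  have hg : ContDiffOn ℝ 1 g s := by
    have h1 : ContDiff ℝ 1 fun x : E ↦ ⟪v, x - p⟫ :=
      contDiff_const.inner ℝ (contDiff_id.sub contDiff_const)
    have h2 : ContDiff ℝ 1 fun x : E ↦ P (x - p) := by fun_prop
    exact (contDiffOn_const.div h1.contDiffOn fun x hx ↦ ne_of_gt hx).smul h2.contDiffOn
  have hfin : (finrank ℝ (ℝ ∙ v)ᗮ : ℝ≥0∞) + 1 = finrank ℝ E := by
    have h := Submodule.finrank_add_finrank_orthogonal (ℝ ∙ v)
    rw [finrank_span_singleton hv0] at h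
    rw [← h]; push_cast; ring
  have hdim : dimH (K ∩ s) < finrank ℝ (ℝ ∙ v)ᗮ := by
    have h1 : dimH (K ∩ s) + 1 < finrank ℝ (ℝ ∙ v)ᗮ + 1 := by
      rw [hfin]
      exact (add_le_add_left (dimH_mono inter_subset_left) 1).trans_lt hK
    exact lt_of_add_lt_add_right h1
  have hdense := hg.dense_compl_image_of_dimH_lt_finrank hs inter_subset_right hdim
  have hmaps : ∀ w ∈ (g '' (K ∩ s))ᶜ, p + v + (w : E) ∈ {q : E | Disjoint (segment ℝ p q) K} := by
    intro w hw
    rw [mem_ofPred_eq, Set.disjoint_left]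
    intro x hx hxK
    obtain ⟨t, ht, rfl⟩ := (segment_eq_image' ℝ p (p + v + w)).subset hx
    rcases ht.1.eq_or_lt with rfl | ht0
    · exact hp (by simpa using hxK)
    have hvw : ⟪v, (w : E)⟫ = 0 := (Submodule.mem_orthogonal_singleton_iff_inner_right).1 w.2
    have hin : ⟪v, p + t • (p + v + w - p) - p⟫ = t * ⟪v, v⟫ := by
      have : p + t • (p + v + w - p) - p = t • v + t • (w : E) := by module
      rw [this, inner_add_right, inner_smul_right, inner_smul_right, hvw]; ring
    have hP : P (p + t • (p + v + w - p) - p) = t • w := by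
      have h1 : p + t • (p + v + w - p) - p = t • v + t • (w : E) := by module
      have h2 : P v = 0 := by
        apply Submodule.orthogonalProjectionOnto_apply_of_mem_orthogonal
        rw [Submodule.orthogonal_orthogonal]
        exact Submodule.mem_span_singleton_self v
      rw [h1, map_add, map_smul, map_smul, h2]
      simp [P]
    apply hw
    refine ⟨_, ⟨hxK, ?_⟩, ?_⟩
    · rw [mem_ofPred_eq, hin]; positivity
    · simp only [g]
      rw [hin, hP, smul_smul]
      have : ⟪v, v⟫ / (t * ⟪v, v⟫) * t = 1 := by field_simp
      rw [this, one_smul]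
  have hcont : Continuous fun w : (ℝ ∙ v)ᗮ ↦ p + v + (w : E) := by fun_prop
  have h0 := map_mem_closure hcont (hdense 0) hmaps
  simpa [hv] using h0

end Visibility

/-! ### Extension of solutions of a prolonged system -/

section Extension

set_option maxSynthPendingDepth 3

open Filter Topology Module
open scoped NNReal

variable {E : Type*} [NormedAddCommGroup E] [NormedSpace ℝ E]
variable {G : Type*} [NormedAddCommGroup G] [NormedSpace ℝ G]

lemma segment_subset_sdiff {B K : Set E} (hB : Convex ℝ B) {p q : E} (hp : p ∈ B) (hq : q ∈ B)
    (h : Disjoint (segment ℝ p q) K) : segment ℝ p q ⊆ B \ K :=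
  fun _ hx ↦ ⟨hB.segment_subset hp hq hx, Set.disjoint_left.1 h hx⟩

omit [NormedSpace ℝ E] in
lemma mem_closure_inter_of_dense {D V : Set E} (hD : IsOpen D) (hV : Dense V) {q : E} (hq : q ∈ D) :
    q ∈ closure (D ∩ V) :=
  hV.open_subset_closure_inter hD hq

/-- Grönwall's inequality along a segment. -/
lemma norm_le_exp_mul_of_segment {f : E → G} {f' : E → E →L[ℝ] G} {C R : ℝ} (hC : 0 ≤ C) {p q : E}
    (hf : ∀ x ∈ segment ℝ p q, HasFDerivAt f (f' x) x)
    (hb : ∀ x ∈ segment ℝ p q, ‖f' x‖ ≤ C * ‖f x‖) (hR : ‖q - p‖ ≤ R) :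
    ‖f q‖ ≤ Real.exp (C * R) * ‖f p‖ := by
  let γ : ℝ → E := fun t ↦ p + t • (q - p)
  have hγ : ∀ t ∈ Icc (0 : ℝ) 1, γ t ∈ segment ℝ p q := fun t ht ↦ by
    rw [segment_eq_image']; exact ⟨t, ht, rfl⟩
  have hγ' : ∀ t, HasDerivAt γ (q - p) t := fun t ↦ by
    have h := ((hasDerivAt_id t).smul_const (q - p)).const_add p
    rwa [one_smul] at h
  have hd : ∀ t ∈ Icc (0 : ℝ) 1, HasDerivAt (fun s ↦ f (γ s)) (f' (γ t) (q - p)) t :=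
    fun t ht ↦ (hf _ (hγ t ht)).comp_hasDerivAt t (hγ' t)
  have h := norm_le_gronwallBound_of_norm_deriv_right_le (f := fun s ↦ f (γ s))
    (f' := fun t ↦ f' (γ t) (q - p)) (δ := ‖f p‖) (K := C * R) (ε := 0) (a := 0) (b := 1)
    (fun t ht ↦ (hd t ht).continuousAt.continuousWithinAt)
    (fun t ht ↦ (hd t (Ico_subset_Icc_self ht)).hasDerivWithinAt) (by simp [γ])
    (fun t ht ↦ by
      have h1 := (f' (γ t)).le_opNorm (q - p)
      have h2 := hb _ (hγ t (Ico_subset_Icc_self ht))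
      calc ‖f' (γ t) (q - p)‖ ≤ ‖f' (γ t)‖ * ‖q - p‖ := h1
        _ ≤ (C * ‖f (γ t)‖) * R := by gcongr
        _ = C * R * ‖f (γ t)‖ + 0 := by ring) 1 (right_mem_Icc.2 zero_le_one)
  rw [gronwallBound_ε0] at h
  simpa [γ, mul_comm] using h

variable {B K : Set E}

/-- On a bounded convex set from which a closed set has been removed through which almost every
segment can pass, the solutions of `‖f'‖ ≤ C ‖f‖` are Lipschitz. -/
lemma exists_lipschitzOnWith_of_norm_fderiv_le (hB : Convex ℝ B) (hbdd : Bornology.IsBounded B)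
    (hD : IsOpen (B \ K)) (hK : ∀ p ∈ B \ K, Dense {q : E | Disjoint (segment ℝ p q) K})
    {f : E → G} {f' : E → E →L[ℝ] G} {C : ℝ} (hC : 0 ≤ C)
    (hf : ∀ x ∈ B \ K, HasFDerivAt f (f' x) x) (hb : ∀ x ∈ B \ K, ‖f' x‖ ≤ C * ‖f x‖) :
    ∃ L : ℝ≥0, LipschitzOnWith L f (B \ K) := by
  rcases (B \ K).eq_empty_or_nonempty with h0 | ⟨p₀, hp₀⟩
  · exact ⟨0, by rw [h0]; exact LipschitzOnWith.of_dist_le_mul (by simp)⟩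
  have hcont : ContinuousOn f (B \ K) := fun x hx ↦ (hf x hx).continuousAt.continuousWithinAt
  have hsub : ∀ {p q}, p ∈ B \ K → q ∈ B \ K ∩ {q : E | Disjoint (segment ℝ p q) K} →
      segment ℝ p q ⊆ B \ K := fun hp hq ↦ segment_subset_sdiff hB hp.1 hq.1.1 hq.2
  obtain ⟨R, hR⟩ := Metric.isBounded_iff.1 hbdd
  -- Grönwall from one base point bounds `f` at the points visible from it; `R` bounds the length of
  -- every segment in `B`. Density and continuity give the bound everywhere.
  set M := Real.exp (C * R) * ‖f p₀‖
  have hM0 : 0 ≤ M := by positivity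
  have hM : ∀ q ∈ B \ K, ‖f q‖ ≤ M := fun q hq ↦ by
    refine ContinuousWithinAt.closure_le (mem_closure_inter_of_dense hD (hK p₀ hp₀) hq)
      ((hcont q hq).mono inter_subset_left).norm continuousWithinAt_const fun y hy ↦ ?_
    refine norm_le_exp_mul_of_segment hC (fun x hx ↦ hf x (hsub hp₀ hy hx))
      (fun x hx ↦ hb x (hsub hp₀ hy hx)) ?_
    rw [← dist_eq_norm]
    exact hR hy.1.1 hp₀.1
  -- Now `‖f'‖ ≤ C * M`, and the mean value inequality on visible segments gives a Lipschitz bound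
  -- in the ambient norm, again completed by density.
  refine ⟨⟨C * M, by positivity⟩, LipschitzOnWith.of_dist_le_mul fun q hq p hp ↦ ?_⟩
  refine ContinuousWithinAt.closure_le (mem_closure_inter_of_dense hD (hK p hp) hq)
    (((hcont q hq).mono inter_subset_left).dist continuousWithinAt_const)
    (continuousWithinAt_const.mul (continuousWithinAt_id.dist continuousWithinAt_const))
    fun y hy ↦ ?_
  change dist (f y) (f p) ≤ C * M * dist y p
  rw [dist_eq_norm, dist_eq_norm]
  refine (convex_segment p y).norm_image_sub_le_of_norm_hasFDerivWithin_le
    (fun x hx ↦ (hf x (hsub hp hy hx)).hasFDerivWithinAt) (fun x hx ↦ ?_)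
    (left_mem_segment ℝ p y) (right_mem_segment ℝ p y)
  have h1 := hb x (hsub hp hy hx)
  have h2 := hM x (hsub hp hy hx)
  calc ‖f' x‖ ≤ C * ‖f x‖ := h1
    _ ≤ C * M := by gcongr

/-- A function whose second derivative is controlled by the function and its first derivative
extends, as a `C^1` function, across a closed set through which almost every segment can pass. -/
lemma exists_contDiffOn_extension [FiniteDimensional ℝ E] [FiniteDimensional ℝ G] (hBo : IsOpen B)
    (hB : Convex ℝ B) (hbdd : Bornology.IsBounded B)
    (hD : IsOpen (B \ K)) (hKd : Dense Kᶜ)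
    (hK : ∀ p ∈ B \ K, Dense {q : E | Disjoint (segment ℝ p q) K})
    {η : E → G} (hη : ContDiffOn ℝ 2 η (B \ K)) {C : ℝ} (hC : 0 ≤ C)
    (hb : ∀ x ∈ B \ K, ‖fderiv ℝ (fderiv ℝ η) x‖ ≤ C * (‖η x‖ + ‖fderiv ℝ η x‖)) :
    ∃ ζ : E → G, ContDiffOn ℝ 1 ζ B ∧ EqOn ζ η (B \ K) := by
  have hat : ∀ x ∈ B \ K, ContDiffAt ℝ 2 η x := fun x hx ↦ hη.contDiffAt (hD.mem_nhds hx)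
  have hd1 : ∀ x ∈ B \ K, HasFDerivAt η (fderiv ℝ η x) x := fun x hx ↦
    ((hat x hx).differentiableAt two_ne_zero).hasFDerivAt
  have hd2 : ∀ x ∈ B \ K, HasFDerivAt (fderiv ℝ η) (fderiv ℝ (fderiv ℝ η) x) x := fun x hx ↦
    (((hat x hx).fderiv_right (m := 1) (by norm_num)).differentiableAt one_ne_zero).hasFDerivAt
  -- In the maximum norm the derivative of the 1-jet is at most `max 1 (2 * C)` times the jet,
  -- whence the constant `1 + 2 * C`.
  obtain ⟨L, hL⟩ := exists_lipschitzOnWith_of_norm_fderiv_le (f := fun x ↦ (η x, fderiv ℝ η x))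
    (f' := fun x ↦ (fderiv ℝ η x).prod (fderiv ℝ (fderiv ℝ η) x)) (C := 1 + 2 * C)
    hB hbdd hD hK (by positivity) (fun x hx ↦ (hd1 x hx).prodMk (hd2 x hx)) (fun x hx ↦ by
      have h1 : ‖η x‖ ≤ ‖(η x, fderiv ℝ η x)‖ := norm_fst_le (η x, fderiv ℝ η x)
      have h2 : ‖fderiv ℝ η x‖ ≤ ‖(η x, fderiv ℝ η x)‖ := norm_snd_le (η x, fderiv ℝ η x)
      have h3 := hb x hx
      have h4 : 0 ≤ ‖(η x, fderiv ℝ η x)‖ := norm_nonneg _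
      rw [ContinuousLinearMap.opNorm_prod, Prod.norm_mk]
      refine max_le (by nlinarith) (h3.trans ?_)
      calc C * (‖η x‖ + ‖fderiv ℝ η x‖)
          ≤ C * (‖(η x, fderiv ℝ η x)‖ + ‖(η x, fderiv ℝ η x)‖) := by gcongr
        _ ≤ _ := by nlinarith)
  obtain ⟨J, hJ, hJη⟩ := hL.extend_finite_dimension
  set L' := lipschitzExtensionConstant (G × (E →L[ℝ] G)) * L
  let ζ : E → G := fun x ↦ (J x).1
  let A : E → E →L[ℝ] G := fun x ↦ (J x).2
  have hζc : Continuous ζ := continuous_fst.comp hJ.continuous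
  have hAc : Continuous A := continuous_snd.comp hJ.continuous
  have hAL : ∀ x y, ‖A x - A y‖ ≤ L' * ‖x - y‖ := fun x y ↦ by
    rw [← dist_eq_norm, ← dist_eq_norm]
    exact (le_max_right _ _).trans (hJ.dist_le_mul x y)
  have hζη : EqOn ζ η (B \ K) := fun x hx ↦ by simp [ζ, ← hJη hx]
  have hAη : EqOn A (fderiv ℝ η) (B \ K) := fun x hx ↦ by simp [A, ← hJη hx]
  -- A Lipschitz extension of the jet need not be a jet; this first-order Taylor estimate restores
  -- the link between `ζ` and `A`. It is proved along segments visible from `p`, then for all `q`,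
  -- and `h2` lets `p` reach `K`.
  have h1 : ∀ p ∈ B \ K, ∀ q ∈ B, ‖ζ q - ζ p - A p (q - p)‖ ≤ L' * ‖q - p‖ * ‖q - p‖ := by
    intro p hp q hq
    have hl : Continuous fun q ↦ ‖ζ q - ζ p - A p (q - p)‖ := by fun_prop
    have hr : Continuous fun q ↦ L' * ‖q - p‖ * ‖q - p‖ := by fun_prop
    refine ContinuousWithinAt.closure_le (mem_closure_inter_of_dense hBo (hK p hp) hq)
      hl.continuousWithinAt hr.continuousWithinAt fun y hy ↦ ?_
    have hsub := segment_subset_sdiff hB hp.1 hy.1 hy.2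
    rw [hζη hp, hζη (hsub (right_mem_segment ℝ p y))]
    refine (convex_segment p y).norm_image_sub_le_of_norm_hasFDerivWithin_le' (f' := A)
      (fun x hx ↦ ?_) (fun x hx ↦ (hAL x p).trans ?_)
      (left_mem_segment ℝ p y) (right_mem_segment ℝ p y)
    · rw [hAη (hsub hx)]
      exact (hd1 x (hsub hx)).hasFDerivWithinAt
    · gcongr
      rw [segment_eq_image'] at hx
      obtain ⟨t, ht, rfl⟩ := hx
      rw [add_sub_cancel_left, norm_smul, Real.norm_of_nonneg ht.1]
      exact mul_le_of_le_one_left (norm_nonneg _) ht.2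
  have h2 : ∀ p ∈ B, ∀ q ∈ B, ‖ζ q - ζ p - A p (q - p)‖ ≤ L' * ‖q - p‖ * ‖q - p‖ := by
    intro p hp q hq
    have hl : Continuous fun p ↦ ‖ζ q - ζ p - A p (q - p)‖ := by fun_prop
    have hr : Continuous fun p ↦ L' * ‖q - p‖ * ‖q - p‖ := by fun_prop
    exact ContinuousWithinAt.closure_le (mem_closure_inter_of_dense hBo hKd hp)
      hl.continuousWithinAt hr.continuousWithinAt fun y hy ↦ h1 y hy q hq
  have h3 : ∀ p ∈ B, HasFDerivAt ζ (A p) p := by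
    intro p hp
    rw [hasFDerivAt_iff_isLittleO]
    have hO : (fun q ↦ ζ q - ζ p - A p (q - p)) =O[𝓝 p] fun q ↦ ‖q - p‖ ^ 2 := by
      refine Asymptotics.IsBigO.of_bound L' ?_
      filter_upwards [hBo.mem_nhds hp] with q hq
      refine (h2 p hp q hq).trans_eq ?_
      rw [Real.norm_of_nonneg (by positivity)]; ring
    refine hO.trans_isLittleO ?_
    exact Asymptotics.isLittleO_pow_sub_sub p one_lt_two
  refine ⟨ζ, ?_, hζη⟩
  intro x hx
  refine ContDiffAt.contDiffWithinAt ?_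
  rw [contDiffAt_one_iff]
  exact ⟨A, B, hBo.mem_nhds hx, hAc.continuousOn, h3⟩

end Extension

/-! ### The Killing equation on an open subset of a vector space -/

section Euclidean

set_option maxSynthPendingDepth 3
set_option synthInstance.maxHeartbeats 100000

open Filter Topology Module ContinuousLinearMap

variable {E : Type*} [NormedAddCommGroup E]

/-- The components at `x` of the Lie derivative of the metric `h` along the vector field `f`, on an
open subset of a vector space. -/
noncomputable def flatLieDeriv [NormedSpace ℝ E] (h : E → E →L[ℝ] E →L[ℝ] ℝ) (f : E → E)
    (x v w : E) : ℝ :=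
  fderiv ℝ h x (f x) v w + h x (fderiv ℝ f x v) w + h x v (fderiv ℝ f x w)

lemma norm_fderiv_clm_apply_le {F G : Type*} [NormedSpace ℝ E] [NormedAddCommGroup F]
    [NormedSpace ℝ F] [NormedAddCommGroup G] [NormedSpace ℝ G] {Q : E → F →L[ℝ] G} {η : E → F}
    {x : E} (hQ : DifferentiableAt ℝ Q x) (hη : DifferentiableAt ℝ η x) :
    ‖fderiv ℝ (fun y ↦ Q y (η y)) x‖ ≤ ‖Q x‖ * ‖fderiv ℝ η x‖ + ‖fderiv ℝ Q x‖ * ‖η x‖ := by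
  rw [fderiv_clm_apply hQ hη]
  refine (norm_add_le _ _).trans (add_le_add (opNorm_comp_le _ _) ?_)
  exact (le_opNorm _ _).trans_eq (by rw [opNorm_flip])

variable [InnerProductSpace ℝ E] [FiniteDimensional ℝ E] {Ω K : Set E} {c : E}

/-- A `C^1` one-form `η` whose symmetrized derivative depends linearly on `η` extends across sets of
codimension larger than one. -/
lemma exists_oneForm_extension (hΩ : IsOpen Ω) (hc : c ∈ Ω) (hK : dimH K + 1 < finrank ℝ E)
    (hΩK : IsOpen (Ω \ K)) {Q : E → (E →L[ℝ] ℝ) →L[ℝ] (E →L[ℝ] E →L[ℝ] ℝ)}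
    (hQ : ContDiffOn ℝ 1 Q Ω) {η : E → E →L[ℝ] ℝ} (hη : ContDiffOn ℝ 1 η (Ω \ K))
    (h : ∀ x ∈ Ω \ K, symmetrizeBilin E (fderiv ℝ η x) = Q x (η x)) :
    ∃ B, IsOpen B ∧ c ∈ B ∧ B ⊆ Ω ∧ ∃ ζ : E → E →L[ℝ] ℝ,
      ContDiffOn ℝ 1 ζ B ∧ EqOn ζ η (B \ K) := by
  obtain ⟨r, hr, hrΩ⟩ := Metric.nhds_basis_closedBall.mem_iff.1 (hΩ.mem_nhds hc)
  have hcomp : IsCompact (Metric.closedBall c r) := isCompact_closedBall c r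
  obtain ⟨C₁, hC₁⟩ := hcomp.exists_bound_of_continuousOn (hQ.continuousOn.mono hrΩ)
  obtain ⟨C₂, hC₂⟩ := hcomp.exists_bound_of_continuousOn
    ((hQ.continuousOn_fderiv_of_isOpen hΩ le_rfl).mono hrΩ)
  have hBΩ : Metric.ball c r ⊆ Ω := Metric.ball_subset_closedBall.trans hrΩ
  have hDΩ : Metric.ball c r \ K ⊆ Ω \ K := sdiff_subset_sdiff_left hBΩ
  have hD : IsOpen (Metric.ball c r \ K) := by
    have : Metric.ball c r \ K = Metric.ball c r ∩ (Ω \ K) := by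
      ext x; exact ⟨fun hx ↦ ⟨hx.1, hDΩ hx⟩, fun hx ↦ ⟨hx.1, hx.2.2⟩⟩
    rw [this]; exact Metric.isOpen_ball.inter hΩK
  have hKd : Dense Kᶜ := dense_compl_of_dimH_lt_finrank (lt_of_le_of_lt le_self_add hK)
  have hC₁0 : 0 ≤ C₁ := (norm_nonneg _).trans (hC₁ c (Metric.mem_closedBall_self hr.le))
  have hS : ContDiffOn ℝ 1 (fun x ↦ symmetrizeBilin E (fderiv ℝ η x)) (Ω \ K) :=
    ((hQ.mono sdiff_subset).clm_apply hη).congr h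
  -- Bootstrap: `Q x (η x)` is `C^1` because `η` is, hence `η` is `C^2`.
  have hη2 := contDiffOn_two_of_symmetrizeBilin hΩK hη hS
  obtain ⟨C₀, hC₀, hpol⟩ := (polarizeTrilin E).bound
  set C := C₀ * max C₁ C₂ with hC
  have hC0 : 0 ≤ C := mul_nonneg hC₀.le (hC₁0.trans (le_max_left _ _))
  obtain ⟨ζ, hζ, hζη⟩ := exists_contDiffOn_extension Metric.isOpen_ball (convex_ball c r)
    Metric.isBounded_ball hD hKd (fun p hp ↦ dense_setOf_disjoint_segment hK hp.2)
    (hη2.mono hDΩ) hC0 fun x hx ↦ by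
      have hxΩ := hDΩ hx
      have hxb := Metric.ball_subset_closedBall hx.1
      have heq : (fun y ↦ symmetrizeBilin E (fderiv ℝ η y)) =ᶠ[𝓝 x] fun y ↦ Q y (η y) := by
        filter_upwards [hΩK.mem_nhds hxΩ] with y hy using h y hy
      rw [fderiv_fderiv_eq_polarizeTrilin (hη2.contDiffAt (hΩK.mem_nhds hxΩ)), heq.fderiv_eq]
      have h1 := norm_fderiv_clm_apply_le
        ((hQ.contDiffAt (hΩ.mem_nhds hxΩ.1)).differentiableAt one_ne_zero)
        ((hη.contDiffAt (hΩK.mem_nhds hxΩ)).differentiableAt one_ne_zero)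
      calc ‖polarizeTrilin E (fderiv ℝ (fun y ↦ Q y (η y)) x)‖
          ≤ C₀ * ‖fderiv ℝ (fun y ↦ Q y (η y)) x‖ := hpol _
        _ ≤ C₀ * (‖Q x‖ * ‖fderiv ℝ η x‖ + ‖fderiv ℝ Q x‖ * ‖η x‖) := by gcongr
        _ ≤ C₀ * (max C₁ C₂ * ‖fderiv ℝ η x‖ + max C₁ C₂ * ‖η x‖) := by
            gcongr
            · exact (hC₁ x hxb).trans (le_max_left _ _)
            · exact (hC₂ x hxb).trans (le_max_right _ _)
        _ = C * (‖η x‖ + ‖fderiv ℝ η x‖) := by rw [hC]; ring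
  exact ⟨_, Metric.isOpen_ball, Metric.mem_ball_self hr, hBΩ, ζ, hζ, hζη⟩

/-- A nondegenerate bilinear form on a finite-dimensional space, as an isomorphism onto the dual. -/
lemma exists_equiv_dual_of_posDef {A : E →L[ℝ] E →L[ℝ] ℝ} (hA : ∀ v, v ≠ 0 → 0 < A v v) :
    ∃ e : E ≃L[ℝ] (E →L[ℝ] ℝ), (e : E →L[ℝ] E →L[ℝ] ℝ) = A := by
  have hinj : Function.Injective A.toLinearMap := by
    rw [injective_iff_map_eq_zero]
    intro v hv
    by_contra hne
    have h0 := hA v hne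
    have hv' : A v = 0 := hv
    simp [hv'] at h0
  have hfin : finrank ℝ E = finrank ℝ (E →L[ℝ] ℝ) :=
    (Subspace.dual_finrank_eq (K := ℝ) (V := E)).symm.trans
      (LinearMap.toContinuousLinearMap (𝕜 := ℝ) (E := E) (F' := ℝ)).finrank_eq
  refine ⟨(LinearEquiv.ofInjectiveOfFinrankEq A.toLinearMap hinj hfin).toContinuousLinearEquiv, ?_⟩
  ext v w
  rfl

/-- Killing fields of a `C^2` metric on an open subset of a vector space extend across sets of
codimension larger than one. -/
theorem exists_flat_killing_extension (hΩ : IsOpen Ω) (hc : c ∈ Ω) (hK : dimH K + 1 < finrank ℝ E)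
    (hΩK : IsOpen (Ω \ K)) {h : E → E →L[ℝ] E →L[ℝ] ℝ} (hh : ContDiffOn ℝ 2 h Ω)
    (hsymm : ∀ x ∈ Ω, ∀ v w, h x v w = h x w v) (hpos : ∀ x ∈ Ω, ∀ v, v ≠ 0 → 0 < h x v v)
    {f : E → E} (hf : ContDiffOn ℝ 1 f (Ω \ K))
    (hLie : ∀ x ∈ Ω \ K, ∀ v w, flatLieDeriv h f x v w = 0) :
    ∃ B, IsOpen B ∧ c ∈ B ∧ B ⊆ Ω ∧ ∃ g : E → E, ContDiffOn ℝ 1 g B ∧ EqOn g f (B \ K) ∧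
      ∀ x ∈ B, ∀ v w, flatLieDeriv h g x v w = 0 := by
  -- Raising of the index. `inverse` is zero at non-invertible maps, which positivity rules out on
  -- `Ω`.
  let J : E → (E →L[ℝ] ℝ) →L[ℝ] E := fun x ↦ inverse (h x)
  have hJh : ∀ x ∈ Ω, ∀ v, J x (h x v) = v := fun x hx v ↦ by
    obtain ⟨e, he⟩ := exists_equiv_dual_of_posDef (hpos x hx)
    simp [J, ← he]
  have hJ : ContDiffOn ℝ 2 J Ω := fun x hx ↦ by
    obtain ⟨e, he⟩ := exists_equiv_dual_of_posDef (hpos x hx)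
    have hi : ContDiffAt ℝ 2 (inverse : (E →L[ℝ] E →L[ℝ] ℝ) → _) (h x) := by
      rw [← he]
      exact contDiffAt_map_inverse e
    exact (ContDiffAt.comp x hi (hh.contDiffAt (hΩ.mem_nhds hx))).contDiffWithinAt
  have hdh : ContDiffOn ℝ 1 (fderiv ℝ h) Ω := hh.fderiv_of_isOpen hΩ (by norm_num)
  let fl : (E →L[ℝ] E →L[ℝ] E →L[ℝ] ℝ) →L[ℝ] (E →L[ℝ] E →L[ℝ] E →L[ℝ] ℝ) :=
    ((flipₗᵢ ℝ E E (E →L[ℝ] ℝ)).toContinuousLinearEquiv :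
      (E →L[ℝ] E →L[ℝ] E →L[ℝ] ℝ) →L[ℝ] (E →L[ℝ] E →L[ℝ] E →L[ℝ] ℝ))
  -- With `f = J x (η x)`, differentiating `η = h(f, ·)` and inserting the Killing equation leaves
  -- `Dh(v)(f, w) + Dh(w)(f, v) - Dh(f)(v, w)`: the derivatives of `f` drop out. The map `fl` moves
  -- `f` to the first slot.
  let Q : E → (E →L[ℝ] ℝ) →L[ℝ] (E →L[ℝ] E →L[ℝ] ℝ) := fun x ↦
    (symmetrizeBilin E ∘L fl (fderiv ℝ h x) - fderiv ℝ h x) ∘L J x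
  have hQ : ContDiffOn ℝ 1 Q Ω := by
    refine ContDiffOn.clm_comp (ContDiffOn.sub ?_ hdh) (hJ.of_le one_le_two)
    exact contDiffOn_const.clm_comp (fl.contDiff.comp_contDiffOn hdh)
  let η : E → E →L[ℝ] ℝ := fun x ↦ h x (f x)
  have hη : ContDiffOn ℝ 1 η (Ω \ K) :=
    ((hh.of_le one_le_two).mono sdiff_subset).clm_apply hf
  have hdiffh : ∀ x ∈ Ω, DifferentiableAt ℝ h x := fun x hx ↦
    (hh.contDiffAt (hΩ.mem_nhds hx)).differentiableAt two_ne_zero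
  have hsym : ∀ x ∈ Ω \ K, symmetrizeBilin E (fderiv ℝ η x) = Q x (η x) := by
    intro x hx
    ext v w
    have hdf : DifferentiableAt ℝ f x :=
      (hf.contDiffAt (hΩK.mem_nhds hx)).differentiableAt one_ne_zero
    have hη' : fderiv ℝ η x = (h x).comp (fderiv ℝ f x) + (fderiv ℝ h x).flip (f x) :=
      fderiv_clm_apply (hdiffh x hx.1) hdf
    have hQ' : Q x (η x) v w = fderiv ℝ h x v (f x) w + fderiv ℝ h x w (f x) v
        - fderiv ℝ h x (f x) v w := by
      have h1 : J x (η x) = f x := hJh x hx.1 (f x)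
      have h2 : Q x (η x) =
          symmetrizeBilin E (fl (fderiv ℝ h x) (J x (η x))) - fderiv ℝ h x (J x (η x)) := rfl
      rw [h2, h1, sub_apply, sub_apply, symmetrizeBilin_apply]
      rfl
    have h0 := hLie x hx v w
    rw [flatLieDeriv, hsymm x hx.1 v] at h0
    rw [hQ', symmetrizeBilin_apply, hη']
    simp only [add_apply, coe_comp, Function.comp_apply, flip_apply]
    linarith
  obtain ⟨B, hBo, hcB, hBΩ, ζ, hζ, hζη⟩ := exists_oneForm_extension hΩ hc hK hΩK hQ hη hsym
  let g : E → E := fun x ↦ J x (ζ x)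
  have hg : ContDiffOn ℝ 1 g B := ((hJ.of_le one_le_two).mono hBΩ).clm_apply hζ
  have hgf : EqOn g f (B \ K) := fun x hx ↦ by
    simp only [g]; rw [hζη hx]; exact hJh x (hBΩ hx.1) (f x)
  have hBK : IsOpen (B \ K) := by
    have : B \ K = B ∩ (Ω \ K) := by
      ext x; exact ⟨fun hx ↦ ⟨hx.1, hBΩ hx.1, hx.2⟩, fun hx ↦ ⟨hx.1, hx.2.2⟩⟩
    rw [this]; exact hBo.inter hΩK
  refine ⟨B, hBo, hcB, hBΩ, g, hg, hgf, fun x hx v w ↦ ?_⟩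
  have hKd : Dense Kᶜ := dense_compl_of_dimH_lt_finrank (lt_of_le_of_lt le_self_add hK)
  -- As `g` is `C^1`, its Killing expression is continuous, and it vanishes on the dense set `B \
  -- K`.
  have hcont : ContinuousOn (fun y ↦ flatLieDeriv h g y v w) B := by
    have c1 : ContinuousOn (fderiv ℝ h) B := hdh.continuousOn.mono hBΩ
    have c2 : ContinuousOn h B := hh.continuousOn.mono hBΩ
    have c3 : ContinuousOn (fderiv ℝ g) B := hg.continuousOn_fderiv_of_isOpen hBo le_rfl
    have c4 : ContinuousOn g B := hg.continuousOn
    unfold flatLieDeriv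
    exact ((((c1.clm_apply c4).clm_apply continuousOn_const).clm_apply continuousOn_const).add
      ((c2.clm_apply (c3.clm_apply continuousOn_const)).clm_apply continuousOn_const)).add
      ((c2.clm_apply continuousOn_const).clm_apply (c3.clm_apply continuousOn_const))
  have hcl : x ∈ closure (B ∩ Kᶜ) := mem_closure_inter_of_dense hBo hKd hx
  have hzero : MapsTo (fun y ↦ flatLieDeriv h g y v w) (B ∩ Kᶜ) {0} := fun y hy ↦ by
    have heq : g =ᶠ[𝓝 y] f := by
      filter_upwards [hBK.mem_nhds hy] with z hz using hgf hz
    have h0 := hLie y ⟨hBΩ hy.1, hy.2⟩ v w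
    simp only [flatLieDeriv, heq.fderiv_eq, heq.self_of_nhds] at h0 ⊢
    exact h0
  simpa using ((hcont x hx).mono inter_subset_left).mem_closure hcl hzero

end Euclidean

/-! ### Charts are locally Lipschitz for the Riemannian distance -/

section ChartLipschitz

set_option maxSynthPendingDepth 3

open Manifold Filter Topology
open scoped NNReal

/-- The trivializations of a Riemannian vector bundle are locally uniformly bounded. -/
lemma eventually_norm_continuousLinearMapAt_le {B F : Type*} [TopologicalSpace B]
    [NormedAddCommGroup F] [NormedSpace ℝ F] {V : B → Type*} [TopologicalSpace (TotalSpace F V)]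
    [∀ x, NormedAddCommGroup (V x)] [∀ x, InnerProductSpace ℝ (V x)] [FiberBundle F V]
    [VectorBundle ℝ F V] [IsContinuousRiemannianBundle F V] (x : B) :
    ∃ C : ℝ≥0, 0 < C ∧ ∀ᶠ y in 𝓝 x, ∀ v : V y,
      ‖(trivializationAt F V x).continuousLinearMapAt ℝ y v‖ₑ ≤ C * ‖v‖ₑ := by
  obtain ⟨C, hC, h⟩ := eventually_norm_trivializationAt_lt F V x
  lift C to ℝ≥0 using hC.le
  refine ⟨C, by exact_mod_cast hC, ?_⟩
  filter_upwards [h] with y hy v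
  refine (ContinuousLinearMap.le_opENorm _ v).trans ?_
  gcongr
  simp only [enorm, nnnorm]
  exact_mod_cast hy.le

variable {E : Type*} [NormedAddCommGroup E] [NormedSpace ℝ E]
  {H : Type*} [TopologicalSpace H] (I : ModelWithCorners ℝ E H)
  {M : Type*} [PseudoEMetricSpace M] [ChartedSpace H M] [IsManifold I 1 M]
  [RiemannianBundle (fun x : M ↦ TangentSpace I x)]
  [IsContinuousRiemannianBundle E (fun x : M ↦ TangentSpace I x)]

omit [IsContinuousRiemannianBundle E (fun x : M ↦ TangentSpace I x)] in
/-- A path along which the derivative of the chart at `x` has norm at most `C` has an image in this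
chart whose endpoints are at distance at most `C` times its length. -/
lemma edist_extChartAt_le_mul_pathELength {x : M} {C : ℝ≥0} {γ : ℝ → M}
    (hγ : CMDiff[Icc 0 1] 1 γ)
    (hC : ∀ t ∈ Icc (0 : ℝ) 1, γ t ∈ (chartAt H x).source ∧
      ∀ v : TangentSpace I (γ t),
        enorm (E := E) (mfderiv I 𝓘(ℝ, E) (extChartAt I x) (γ t) v) ≤ C * ‖v‖ₑ) :
    edist (extChartAt I x (γ 0)) (extChartAt I x (γ 1)) ≤ C * pathELength I γ 0 1 := by
  let γ' := extChartAt I x ∘ γ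
  have hγ' : CMDiff[Icc 0 1] 1 γ' :=
    contMDiffOn_extChartAt.comp (I' := I) (t := (chartAt H x).source) hγ fun t ht ↦ (hC t ht).1
  calc edist (extChartAt I x (γ 0)) (extChartAt I x (γ 1))
    _ = ‖γ' 1 - γ' 0‖ₑ := by rw [edist_comm, edist_eq_enorm_sub]; rfl
    _ ≤ ∫⁻ t in Icc 0 1, ‖derivWithin γ' (Icc 0 1) t‖ₑ := by
      apply enorm_sub_le_lintegral_derivWithin_Icc_of_contDiffOn_Icc _ zero_le_one
      rwa [← contMDiffOn_iff_contDiffOn]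
    _ ≤ ∫⁻ t in Icc 0 1, C * ‖mfderiv[Icc 0 1] γ t 1‖ₑ := by
      apply MeasureTheory.setLIntegral_mono' measurableSet_Icc (fun t ht ↦ ?_)
      have h1 : mfderiv[Icc 0 1] γ' t =
          (mfderiv% (extChartAt I x) (γ t)) ∘L (mfderiv[Icc 0 1] γ t) := by
        apply mfderiv_comp_mfderivWithin
        · exact mdifferentiableAt_extChartAt (hC t ht).1
        · exact hγ.mdifferentiableOn one_ne_zero _ ht
        · rw [uniqueMDiffWithinAt_iff_uniqueDiffWithinAt]
          exact uniqueDiffOn_Icc zero_lt_one _ ht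
      have h2 : derivWithin γ' (Icc 0 1) t =
          (mfderiv% (extChartAt I x) (γ t)) (mfderiv[Icc 0 1] γ t 1) := by
        rw [← fderivWithin_derivWithin, ← mfderivWithin_eq_fderivWithin]
        exact congr($h1 1)
      rw [h2]
      exact (hC t ht).2 _
    _ = C * pathELength I γ 0 1 := by
      rw [MeasureTheory.lintegral_const_mul' _ _ ENNReal.coe_ne_top,
          pathELength_eq_lintegral_mfderivWithin_Icc]

/-- On a Riemannian manifold, extended charts are locally Lipschitz. -/
lemma exists_lipschitzOnWith_extChartAt [IsRiemannianManifold I M] (x : M) :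
    ∃ C : ℝ≥0, ∃ s ∈ 𝓝 x, LipschitzOnWith C (extChartAt I x) s := by
  obtain ⟨C, hC0, hC⟩ := eventually_norm_continuousLinearMapAt_le
    (F := E) (V := fun x : M ↦ TangentSpace I x) x
  obtain ⟨δ, hδ, hball⟩ := EMetric.mem_nhds_iff.1
    (inter_mem hC (chart_source_mem_nhds H x))
  -- Two points of the ball of radius `δ / 4` are joined by a path of length less than `δ / 2`,
  -- which cannot leave the ball of radius `δ` where the chart derivative is bounded.
  refine ⟨C, Metric.eball x (δ / 2 / 2), Metric.eball_mem_nhds x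
    (ENNReal.half_pos (ENNReal.half_pos hδ.ne').ne'), fun y hy z hz ↦ ?_⟩
  rw [Metric.mem_eball] at hy hz
  have hyz : edist y z < δ / 2 := by
    rw [← ENNReal.add_halves (δ / 2)]
    exact (edist_triangle_right y z x).trans_lt (ENNReal.add_lt_add hy hz)
  -- The distance is an infimum of lengths that need not be attained, so any larger `r` is used and
  -- then decreased to it.
  have key : ∀ r, edist y z < r →
      edist (extChartAt I x y) (extChartAt I x z) ≤ C * r := by
    intro r hr
    have hr' : riemannianEDist I y z < min r (δ / 2) := by
      rw [← IsRiemannianManifold.out]; exact lt_min hr hyz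
    obtain ⟨γ, rfl, rfl, hγ, hlen⟩ := exists_lt_of_riemannianEDist_lt hr'
    refine (edist_extChartAt_le_mul_pathELength I (C := C) hγ fun t ht ↦ ?_).trans ?_
    · have h1 : edist (γ 0) (γ t) < δ / 2 := by
        rw [IsRiemannianManifold.out (I := I)]
        exact ((riemannianEDist_le_pathELength (hγ.mono (Icc_subset_Icc_right ht.2)) rfl rfl
          ht.1).trans (pathELength_mono le_rfl ht.2)).trans_lt (hlen.trans_le (min_le_right _ _))
      have h2 : γ t ∈ Metric.eball x δ := by
        rw [Metric.mem_eball, ← ENNReal.add_halves δ]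
        refine (edist_triangle_left (γ t) x (γ 0)).trans_lt (ENNReal.add_lt_add h1 ?_)
        exact hy.trans_le ENNReal.half_le_self
      refine ⟨(hball h2).2, fun v ↦ ?_⟩
      have h3 := (hball h2).1 v
      rwa [TangentBundle.continuousLinearMapAt_trivializationAt (hball h2).2] at h3
    · gcongr
      exact (hlen.trans_le (min_le_left _ _)).le
  have hC0' : (C : ℝ≥0∞) ≠ 0 := by exact_mod_cast hC0.ne'
  rw [← ENNReal.div_le_iff' hC0' ENNReal.coe_ne_top]
  refine le_of_forall_gt_imp_ge_of_dense fun r hr ↦ ?_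
  rw [ENNReal.div_le_iff' hC0' ENNReal.coe_ne_top]
  exact key r hr

end ChartLipschitz

/-! ### Vector fields, metric and Lie derivative in a chart -/

section ChartMetric

set_option maxSynthPendingDepth 3

open Manifold Filter Topology VectorField

variable {E : Type*} [NormedAddCommGroup E] [NormedSpace ℝ E]
  {H : Type*} [TopologicalSpace H] (I : ModelWithCorners ℝ E H)
  {M : Type*} [TopologicalSpace M] [ChartedSpace H M]

/-- The expression of a vector field in the extended chart at `c`. -/
noncomputable def chartField (c : M) (V : Π x : M, TangentSpace I x) (x : E) : E :=
  mpullback 𝓘(ℝ, E) I (extChartAt I c).symm V x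

/-- The vector field whose expression in the extended chart at `c` is `g`. -/
noncomputable def ofChartField (c : M) (g : E → E) (y : M) : TangentSpace I y :=
  mpullback I 𝓘(ℝ, E) (extChartAt I c) g y

/-- The derivative of the inverse of the extended chart at `c`. -/
noncomputable def chartSymmDeriv (c : M) (x : E) :
    E →L[ℝ] TangentSpace I ((extChartAt I c).symm x) :=
  mfderiv 𝓘(ℝ, E) I (extChartAt I c).symm x

variable {I} {c : M} {x : E}

section

variable [IsManifold I 1 M] [RiemannianBundle (fun x : M ↦ TangentSpace I x)] {n : ℕ∞ω}
  [IsContMDiffRiemannianBundle I n E (fun x : M ↦ TangentSpace I x)]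

lemma contMDiffOn_inner_of_contMDiffOn {f : E → M} {s : Set E}
    {V W : Π x, TangentSpace I (f x)}
    (hV : ContMDiffOn 𝓘(ℝ, E) I.tangent n (fun y ↦ (⟨f y, V y⟩ : TangentBundle I M)) s)
    (hW : ContMDiffOn 𝓘(ℝ, E) I.tangent n (fun y ↦ (⟨f y, W y⟩ : TangentBundle I M)) s) :
    ContMDiffOn 𝓘(ℝ, E) 𝓘(ℝ, ℝ) n (fun y ↦ inner ℝ (V y) (W y)) s :=
  ContMDiffOn.inner_bundle hV hW

lemma contMDiffAt_inner_of_contMDiffAt {V W : Π x : M, TangentSpace I x} {y : M}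
    (hV : ContMDiffAt I I.tangent n (fun y ↦ (⟨y, V y⟩ : TangentBundle I M)) y)
    (hW : ContMDiffAt I I.tangent n (fun y ↦ (⟨y, W y⟩ : TangentBundle I M)) y) :
    ContMDiffAt I 𝓘(ℝ, ℝ) n (fun y ↦ inner ℝ (V y) (W y)) y :=
  ContMDiffAt.inner_bundle hV hW

end

lemma contMDiffAt_extChartAt_symm_of_mem [I.Boundaryless] {n : ℕ∞ω} [IsManifold I n M]
    (hx : x ∈ (extChartAt I c).target) :
    ContMDiffAt 𝓘(ℝ, E) I n (extChartAt I c).symm x :=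
  (contMDiffOn_extChartAt_symm c).contMDiffAt ((isOpen_extChartAt_target c).mem_nhds hx)

section

variable [IsManifold I 1 M]

lemma isInvertible_mfderiv_extChartAt_symm [I.Boundaryless] (hx : x ∈ (extChartAt I c).target) :
    (mfderiv 𝓘(ℝ, E) I (extChartAt I c).symm x).IsInvertible := by
  have h := isInvertible_mfderivWithin_extChartAt_symm hx
  rwa [I.range_eq_univ, mfderivWithin_univ] at h

lemma chartSymmDeriv_comp_mfderiv [I.Boundaryless] (hx : x ∈ (extChartAt I c).target) :
    (mfderiv 𝓘(ℝ, E) I (extChartAt I c).symm x) ∘L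
      (mfderiv I 𝓘(ℝ, E) (extChartAt I c) ((extChartAt I c).symm x)) =
      ContinuousLinearMap.id ℝ _ := by
  have h := mfderivWithin_extChartAt_symm_comp_mfderiv_extChartAt hx
  rwa [I.range_eq_univ, mfderivWithin_univ] at h

lemma chartSymmDeriv_chartField [I.Boundaryless] (V : Π x : M, TangentSpace I x)
    (hx : x ∈ (extChartAt I c).target) :
    chartSymmDeriv I c x (chartField I c V x) = V ((extChartAt I c).symm x) :=
  (isInvertible_mfderiv_extChartAt_symm hx).self_apply_inverse _

lemma chartSymmDeriv_injective [I.Boundaryless] (hx : x ∈ (extChartAt I c).target) :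
    Function.Injective (chartSymmDeriv I c x) :=
  (isInvertible_mfderiv_extChartAt_symm hx).injective

lemma ofChartField_symm [I.Boundaryless] (g : E → E) (hx : x ∈ (extChartAt I c).target) :
    ofChartField I c g ((extChartAt I c).symm x) = chartSymmDeriv I c x (g x) := by
  have hy := (extChartAt I c).map_target hx
  have h1 : mfderiv I 𝓘(ℝ, E) (extChartAt I c) ((extChartAt I c).symm x)
      (ofChartField I c g ((extChartAt I c).symm x)) = g x := by
    have h2 := (isInvertible_mfderiv_extChartAt hy).self_apply_inverse
      (g (extChartAt I c ((extChartAt I c).symm x)))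
    refine Eq.trans h2 ?_
    rw [(extChartAt I c).right_inv hx]
  have h3 := congr($(chartSymmDeriv_comp_mfderiv hx) (ofChartField I c g ((extChartAt I c).symm x)))
  refine h3.symm.trans ?_
  exact congrArg (chartSymmDeriv I c x) h1

lemma chartField_ofChartField [I.Boundaryless] (g : E → E) (hx : x ∈ (extChartAt I c).target) :
    chartField I c (ofChartField I c g) x = g x := by
  apply chartSymmDeriv_injective hx
  rw [chartSymmDeriv_chartField _ hx, ofChartField_symm g hx]

end

section

variable [IsManifold I 2 M] [CompleteSpace E]

lemma contDiffAt_chartField [I.Boundaryless] {V : Π x : M, TangentSpace I x}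
    (hx : x ∈ (extChartAt I c).target)
    (hV : ContMDiffAt I I.tangent 1 (fun y ↦ (⟨y, V y⟩ : TangentBundle I M))
      ((extChartAt I c).symm x)) :
    ContDiffAt ℝ 1 (chartField I c V) x :=
  contMDiffAt_vectorSpace_iff_contDiffAt.1 <|
    hV.mpullback_vectorField_preimage (contMDiffAt_extChartAt_symm_of_mem (n := 2) hx)
      (isInvertible_mfderiv_extChartAt_symm hx) (by norm_num)

lemma contMDiffAt_ofChartField {g : E → E} {y : M} (hy : y ∈ (extChartAt I c).source)
    (hg : ContDiffAt ℝ 1 g (extChartAt I c y)) :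
    ContMDiffAt I I.tangent 1
      (fun z ↦ (⟨z, ofChartField I c g z⟩ : TangentBundle I M)) y :=
  ContMDiffAt.mpullback_vectorField_preimage (contMDiffAt_vectorSpace_iff_contDiffAt.2 hg)
    (contMDiffAt_extChartAt' (n := 2) (by rwa [extChartAt_source] at hy))
      (isInvertible_mfderiv_extChartAt hy) (by norm_num)

/-- Naturality of the Lie bracket under pullback by the inverse chart. -/
lemma mlieBracket_eq_chartSymmDeriv [I.Boundaryless] {V W : Π x : M, TangentSpace I x}
    (hx : x ∈ (extChartAt I c).target)
    (hV : ContMDiffAt I I.tangent 1 (fun y ↦ (⟨y, V y⟩ : TangentBundle I M))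
      ((extChartAt I c).symm x))
    (hW : ContMDiffAt I I.tangent 1 (fun y ↦ (⟨y, W y⟩ : TangentBundle I M))
      ((extChartAt I c).symm x)) :
    mlieBracket I V W ((extChartAt I c).symm x) =
      chartSymmDeriv I c x (lieBracket ℝ (chartField I c V) (chartField I c W) x) := by
  have : IsManifold I (minSmoothness ℝ 2) M := by
    rwa [minSmoothness_of_isRCLikeNormedField]
  have h := mpullback_mlieBracket (I := 𝓘(ℝ, E)) (n := 2) (f := (extChartAt I c).symm)
    (hV.mdifferentiableAt one_ne_zero) (hW.mdifferentiableAt one_ne_zero)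
    (contMDiffAt_extChartAt_symm_of_mem hx) (by rw [minSmoothness_of_isRCLikeNormedField])
  have h1 : chartField I c (mlieBracket I V W) x =
      lieBracket ℝ (chartField I c V) (chartField I c W) x := by
    refine Eq.trans h ?_
    rw [← mlieBracketWithin_univ, mlieBracketWithin_eq_lieBracketWithin]
    exact congrFun (lieBracketWithin_univ (V := chartField I c V) (W := chartField I c W)) x
  rw [← h1, chartSymmDeriv_chartField _ hx]

end

section

variable [IsManifold I 1 M] [IsManifold I 3 M] [I.Boundaryless]

/-- Coordinate fields are images of constant fields under the tangent map of the inverse chart. This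
costs one derivative, so `C^3` charts give the `C^2` fields needed for `C^2` metric coefficients. -/
lemma contMDiffOn_chartSymmDeriv (c : M) (v : E) :
    ContMDiffOn 𝓘(ℝ, E) I.tangent 2
      (fun x ↦ (⟨(extChartAt I c).symm x, chartSymmDeriv I c x v⟩ : TangentBundle I M))
      (extChartAt I c).target := by
  have ho := isOpen_extChartAt_target (I := I) c
  have h1 := (contMDiffOn_extChartAt_symm (I := I) (n := 3) c).contMDiffOn_tangentMapWithin
    (m := 2) (by norm_num) ho.uniqueMDiffOn
  have h2 : ContMDiff 𝓘(ℝ, E) 𝓘(ℝ, E).tangent 2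
      (fun x : E ↦ (⟨x, v⟩ : TangentBundle 𝓘(ℝ, E) E)) :=
    contMDiff_vectorSpace_iff_contDiff.2 contDiff_const
  refine (h1.comp h2.contMDiffOn fun x hx ↦ hx).congr fun x hx ↦ ?_
  simp only [Function.comp_apply, tangentMapWithin]
  rw [mfderivWithin_of_isOpen ho hx]
  rfl

variable [FiniteDimensional ℝ E]
  [RiemannianBundle (fun x : M ↦ TangentSpace I x)]
  [IsContMDiffRiemannianBundle I 2 E (fun x : M ↦ TangentSpace I x)]

/-- The expression of a `C^2` Riemannian metric in an extended chart. -/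
lemma exists_chartMetric (c : M) : ∃ h : E → E →L[ℝ] E →L[ℝ] ℝ,
    ContDiffOn ℝ 2 h (extChartAt I c).target ∧ ∀ x v w, h x v w =
      inner ℝ (chartSymmDeriv I c x v) (chartSymmDeriv I c x w) := by
  obtain ⟨g, -, hg⟩ := IsContMDiffRiemannianBundle.exists_contMDiff (IB := I) (n := 2) (F := E)
    (E := fun x : M ↦ TangentSpace I x)
  let h : E → E →L[ℝ] E →L[ℝ] ℝ := fun x ↦
    (g ((extChartAt I c).symm x)).bilinearComp (chartSymmDeriv I c x) (chartSymmDeriv I c x)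
  have hh : ∀ x v w, h x v w = inner ℝ (chartSymmDeriv I c x v) (chartSymmDeriv I c x w) :=
    fun x v w ↦ (hg _ _ _).symm
  have hsmooth : ∀ v w, ContDiffOn ℝ 2
      (fun x ↦ (inner ℝ (chartSymmDeriv I c x v) (chartSymmDeriv I c x w) : ℝ))
      (extChartAt I c).target := fun v w ↦
    (contMDiffOn_inner_of_contMDiffOn (contMDiffOn_chartSymmDeriv c v) (contMDiffOn_chartSymmDeriv c w)).contDiffOn
  exact ⟨h, contDiffOn_clm_apply.2 fun v ↦ contDiffOn_clm_apply.2 fun w ↦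
    (hsmooth v w).congr fun x _ ↦ hh x v w, hh⟩

end

section

variable [IsManifold I 1 M] [IsManifold I 2 M] [CompleteSpace E]
  [RiemannianBundle (fun x : M ↦ TangentSpace I x)]
  [IsContMDiffRiemannianBundle I 1 E (fun x : M ↦ TangentSpace I x)] [I.Boundaryless]

/-- The Lie derivative of the metric in an extended chart. -/
lemma lieDerivMetric_eq_flatLieDeriv {h : E → E →L[ℝ] E →L[ℝ] ℝ}
    (hh : ∀ x v w, h x v w = inner ℝ (chartSymmDeriv I c x v) (chartSymmDeriv I c x w))
    (hx : x ∈ (extChartAt I c).target) (hhx : DifferentiableAt ℝ h x)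
    {ξ V W : Π x : M, TangentSpace I x}
    (hξ : ContMDiffAt I I.tangent 1 (fun y ↦ (⟨y, ξ y⟩ : TangentBundle I M))
      ((extChartAt I c).symm x))
    (hV : ContMDiffAt I I.tangent 1 (fun y ↦ (⟨y, V y⟩ : TangentBundle I M))
      ((extChartAt I c).symm x))
    (hW : ContMDiffAt I I.tangent 1 (fun y ↦ (⟨y, W y⟩ : TangentBundle I M))
      ((extChartAt I c).symm x)) :
    lieDerivMetric I ξ V W ((extChartAt I c).symm x) =
      flatLieDeriv h (chartField I c ξ) x (chartField I c V x) (chartField I c W x) := by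
  have dξ := (contDiffAt_chartField hx hξ).differentiableAt one_ne_zero
  have dV := (contDiffAt_chartField hx hV).differentiableAt one_ne_zero
  have dW := (contDiffAt_chartField hx hW).differentiableAt one_ne_zero
  let F : M → ℝ := fun y ↦ inner ℝ (V y) (W y)
  have hF : MDifferentiableAt I 𝓘(ℝ, ℝ) F ((extChartAt I c).symm x) :=
    (contMDiffAt_inner_of_contMDiffAt hV hW).mdifferentiableAt one_ne_zero
  have hφ : MDifferentiableAt 𝓘(ℝ, E) I (extChartAt I c).symm x :=
    (contMDiffAt_extChartAt_symm_of_mem (n := 2) hx).mdifferentiableAt two_ne_zero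
  have heq : F ∘ (extChartAt I c).symm =ᶠ[𝓝 x]
      fun z ↦ h z (chartField I c V z) (chartField I c W z) := by
    filter_upwards [(isOpen_extChartAt_target (I := I) c).mem_nhds hx] with z hz
    rw [hh, chartSymmDeriv_chartField _ hz, chartSymmDeriv_chartField _ hz]
    rfl
  have hder : fderiv ℝ (F ∘ (extChartAt I c).symm) x (chartField I c ξ x) =
      fderiv ℝ h x (chartField I c ξ x) (chartField I c V x) (chartField I c W x)
      + h x (fderiv ℝ (chartField I c V) x (chartField I c ξ x)) (chartField I c W x)
      + h x (chartField I c V x) (fderiv ℝ (chartField I c W) x (chartField I c ξ x)) := by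
    rw [heq.fderiv_eq, ((hhx.hasFDerivAt.clm_apply dV.hasFDerivAt).clm_apply dW.hasFDerivAt).fderiv]
    simp only [add_apply, ContinuousLinearMap.coe_comp,
      Function.comp_apply, ContinuousLinearMap.flip_apply]
    ring
  have h1 : mvfderiv I F ((extChartAt I c).symm x) (ξ ((extChartAt I c).symm x)) =
      fderiv ℝ (F ∘ (extChartAt I c).symm) x (chartField I c ξ x) := by
    let u : E := chartField I c ξ x
    have h2 := mvfderiv_comp_apply x hF hφ u
    have h3 : mfderiv 𝓘(ℝ, E) I (extChartAt I c).symm x u =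
      ξ ((extChartAt I c).symm x) := chartSymmDeriv_chartField ξ hx
    rw [h3] at h2
    rw [← h2, mvfderiv, mfderiv_eq_fderiv]
    rfl
  -- The derivatives of `V` and `W` along `ξ` cancel against those in the brackets; only the values
  -- of `V` and `W` at the point remain.
  unfold lieDerivMetric
  rw [h1, hder, mlieBracket_eq_chartSymmDeriv hx hξ hV, mlieBracket_eq_chartSymmDeriv hx hξ hW,
    ← chartSymmDeriv_chartField W hx, ← chartSymmDeriv_chartField V hx, ← hh, ← hh]
  simp only [flatLieDeriv, lieBracket, map_sub, sub_apply]
  ring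

end

end ChartMetric

/-! ### Local extension on the manifold and gluing -/

section Killing

set_option maxSynthPendingDepth 3

open Manifold Filter Topology VectorField Module

/-- A `C^n` Riemannian bundle is a continuous Riemannian bundle. -/
lemma isContinuousRiemannianBundle_of_isContMDiffRiemannianBundle
    {EB : Type*} [NormedAddCommGroup EB] [NormedSpace ℝ EB] {HB : Type*} [TopologicalSpace HB]
    {IB : ModelWithCorners ℝ EB HB} {n : ℕ∞ω} {B : Type*} [TopologicalSpace B] [ChartedSpace HB B]
    {F : Type*} [NormedAddCommGroup F] [NormedSpace ℝ F] {V : B → Type*}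
    [TopologicalSpace (TotalSpace F V)] [∀ x, NormedAddCommGroup (V x)]
    [∀ x, InnerProductSpace ℝ (V x)] [FiberBundle F V] [VectorBundle ℝ F V]
    [h : IsContMDiffRiemannianBundle IB n F V] : IsContinuousRiemannianBundle F V :=
  let ⟨g, hg, hg'⟩ := h.exists_contMDiff
  ⟨g, hg.continuous, hg'⟩

variable {E : Type*} [NormedAddCommGroup E] [InnerProductSpace ℝ E] [FiniteDimensional ℝ E]
  {H : Type*} [TopologicalSpace H] {I : ModelWithCorners ℝ E H} [I.Boundaryless]

section

variable {M : Type*} [TopologicalSpace M] [ChartedSpace H M] [IsManifold I 1 M] [IsManifold I 3 M]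
  [RiemannianBundle (fun x : M ↦ TangentSpace I x)]
  [IsContMDiffRiemannianBundle I 2 E (fun x : M ↦ TangentSpace I x)]

/-- The Killing equation at a point, in an extended chart. -/
lemma forall_lieDerivMetric_eq_zero_iff {c : M} {x : E} {h : E → E →L[ℝ] E →L[ℝ] ℝ}
    (hh : ∀ x v w, h x v w = inner ℝ (chartSymmDeriv I c x v) (chartSymmDeriv I c x w))
    (hx : x ∈ (extChartAt I c).target) (hhx : DifferentiableAt ℝ h x)
    {ξ : Π x : M, TangentSpace I x}
    (hξ : ContMDiffAt I I.tangent 1 (fun y ↦ (⟨y, ξ y⟩ : TangentBundle I M))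
      ((extChartAt I c).symm x)) :
    (∀ V W : Π y : M, TangentSpace I y,
      ContMDiffAt I I.tangent 1 (fun y ↦ (⟨y, V y⟩ : TangentBundle I M))
        ((extChartAt I c).symm x) →
      ContMDiffAt I I.tangent 1 (fun y ↦ (⟨y, W y⟩ : TangentBundle I M))
        ((extChartAt I c).symm x) →
      lieDerivMetric I ξ V W ((extChartAt I c).symm x) = 0) ↔
    ∀ v w, flatLieDeriv h (chartField I c ξ) x v w = 0 := by
  refine ⟨fun H v w ↦ ?_, fun H V W hV hW ↦ ?_⟩
  -- Fields with constant coefficients in the chart realize all pairs of values `v`, `w`.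
  · have hconst : ∀ v : E, ContMDiffAt I I.tangent 1
        (fun y ↦ (⟨y, ofChartField I c (fun _ ↦ v) y⟩ : TangentBundle I M))
        ((extChartAt I c).symm x) := fun v ↦
      contMDiffAt_ofChartField ((extChartAt I c).map_target hx) contDiffAt_const
    have h1 := H _ _ (hconst v) (hconst w)
    rwa [lieDerivMetric_eq_flatLieDeriv hh hx hhx hξ (hconst v) (hconst w),
      chartField_ofChartField _ hx, chartField_ofChartField _ hx] at h1
  · rw [lieDerivMetric_eq_flatLieDeriv hh hx hhx hξ hV hW, H]

omit [IsManifold I 3 M] [I.Boundaryless] [FiniteDimensional ℝ E]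
  [IsContMDiffRiemannianBundle I 2 E (fun x : M ↦ TangentSpace I x)] in
lemma IsKillingFieldOn.congr {ξ ζ : Π x : M, TangentSpace I x} {s : Set M} (hs : IsOpen s)
    (hξ : IsKillingFieldOn I ξ s) (h : ∀ x ∈ s, ζ x = ξ x) : IsKillingFieldOn I ζ s := by
  refine ⟨hξ.1.congr fun x hx ↦ by rw [h x hx], fun x hx V W hV hW ↦ ?_⟩
  have heq : ζ =ᶠ[𝓝 x] ξ := by filter_upwards [hs.mem_nhds hx] with y hy using h y hy
  rw [← hξ.2 x hx V W hV hW]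
  unfold lieDerivMetric
  rw [heq.mlieBracket_vectorField_eq (EventuallyEq.refl _ V),
    heq.mlieBracket_vectorField_eq (EventuallyEq.refl _ W), h x hx]

omit [RiemannianBundle (fun x : M ↦ TangentSpace I x)]
  [IsContMDiffRiemannianBundle I 2 E (fun x : M ↦ TangentSpace I x)] in
/-- Two `C^1` vector fields which coincide on a set coincide on its closure. -/
lemma eq_of_eqOn_of_mem_closure {ξ ζ : Π x : M, TangentSpace I x} {U s : Set M} {x : M}
    (hU : U ∈ 𝓝 x)
    (hξ : ContMDiffAt I I.tangent 1 (fun y ↦ (⟨y, ξ y⟩ : TangentBundle I M)) x)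
    (hζ : ContMDiffAt I I.tangent 1 (fun y ↦ (⟨y, ζ y⟩ : TangentBundle I M)) x)
    (h : ∀ y ∈ U ∩ s, ξ y = ζ y) (hx : x ∈ closure s) : ξ x = ζ x := by
  have hsrc : (extChartAt I x).source ∈ 𝓝 x := extChartAt_source_mem_nhds x
  have hxt := mem_extChartAt_target (I := I) x
  have hinv : (extChartAt I x).symm (extChartAt I x x) = x := extChartAt_to_inv x
  -- The fields take values in varying fibres; their chart expressions lie in the fixed space `E`,
  -- where a limit argument applies.
  have key : ∀ χ : Π x : M, TangentSpace I x,
      ContMDiffAt I I.tangent 1 (fun y ↦ (⟨y, χ y⟩ : TangentBundle I M)) x →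
      ContinuousAt (fun y ↦ chartField I x χ (extChartAt I x y)) x := fun χ hχ ↦
    ContinuousAt.comp (g := chartField I x χ)
      (contDiffAt_chartField hxt (by rwa [hinv])).continuousAt (continuousAt_extChartAt x)
  have h1 : chartField I x ξ (extChartAt I x x) = chartField I x ζ (extChartAt I x x) := by
    have hcl : x ∈ closure (s ∩ (U ∩ (extChartAt I x).source)) :=
      mem_closure_iff_nhdsWithin_neBot.2 <| by
        rw [nhdsWithin_inter_of_mem' (mem_nhdsWithin_of_mem_nhds (inter_mem hU hsrc))]
        exact mem_closure_iff_nhdsWithin_neBot.1 hx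
    have h2 := ((key ξ hξ).sub (key ζ hζ)).continuousWithinAt.mem_closure (t := {0}) hcl
      fun y hy ↦ by
        have hy' := (extChartAt I x).map_source hy.2.2
        refine sub_eq_zero.2 (chartSymmDeriv_injective hy' ?_)
        rw [chartSymmDeriv_chartField _ hy', chartSymmDeriv_chartField _ hy',
          (extChartAt I x).left_inv hy.2.2]
        exact h y ⟨hy.2.1, hy.1⟩
    simpa [sub_eq_zero] using h2
  have h3 := congrArg (chartSymmDeriv I x (extChartAt I x x)) h1
  rwa [chartSymmDeriv_chartField _ hxt, chartSymmDeriv_chartField _ hxt, hinv] at h3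

end

variable {M : Type*} [EMetricSpace M] [ChartedSpace H M] [IsManifold I 1 M]
  [IsManifold I 3 M] [RiemannianBundle (fun x : M ↦ TangentSpace I x)]
  [IsContMDiffRiemannianBundle I 2 E (fun x : M ↦ TangentSpace I x)]
  [IsRiemannianManifold I M] {Z : Set M}

/-- Killing fields extend locally across closed sets of codimension larger than one. -/
lemma exists_local_killing_extension (hZ : IsClosed Z) (hdim : dimH Z + 1 < finrank ℝ E)
    {ξ : Π x : M, TangentSpace I x} (hξ : IsKillingFieldOn I ξ Zᶜ) (c : M) :
    c ∈ closure Zᶜ ∧ ∃ U, IsOpen U ∧ c ∈ U ∧ ∃ ζ : Π x : M, TangentSpace I x,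
      IsKillingFieldOn I ζ U ∧ ∀ x ∈ U \ Z, ζ x = ξ x := by
  have : IsContinuousRiemannianBundle E (fun x : M ↦ TangentSpace I x) :=
    isContinuousRiemannianBundle_of_isContMDiffRiemannianBundle (IB := I) (n := 2)
  obtain ⟨C, s, hs, hLip⟩ := exists_lipschitzOnWith_extChartAt I c
  obtain ⟨t, hts, hto, hct⟩ := mem_nhds_iff.1 (inter_mem hs (extChartAt_source_mem_nhds (I := I) c))
  obtain ⟨h, hh2, hh⟩ := exists_chartMetric (I := I) c
  have hcont := continuousOn_extChartAt_symm (I := I) c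
  have hTo := isOpen_extChartAt_target (I := I) c
  set φ := (extChartAt I c).symm with hφ
  set T := (extChartAt I c).target with hT
  let Ω : Set E := T ∩ φ ⁻¹' t
  have hΩ : IsOpen Ω := hcont.isOpen_inter_preimage hTo hto
  have hcΩ : extChartAt I c c ∈ Ω :=
    ⟨mem_extChartAt_target c, by rw [mem_preimage, extChartAt_to_inv]; exact hct⟩
  -- Only the part of `Z` in `t`, where the chart is Lipschitz, is transported, so the dimension
  -- bound survives.
  let K : Set E := extChartAt I c '' (Z ∩ t)
  have hKdim : dimH K + 1 < finrank ℝ E := by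
    refine lt_of_le_of_lt ?_ hdim
    gcongr
    exact (hLip.mono fun y hy ↦ (hts hy.2).1).dimH_image_le.trans (dimH_mono inter_subset_left)
  have hΩK : ∀ x ∈ Ω, x ∈ K ↔ φ x ∈ Z := by
    intro x hx
    constructor
    · rintro ⟨z, hz, rfl⟩
      rw [hφ, (extChartAt I c).left_inv (hts hz.2).2]
      exact hz.1
    · intro hxZ
      exact ⟨φ x, ⟨hxZ, hx.2⟩, (extChartAt I c).right_inv hx.1⟩
  have hΩKeq : Ω \ K = T ∩ φ ⁻¹' (t ∩ Zᶜ) := by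
    ext x
    constructor
    · exact fun hx ↦ ⟨hx.1.1, hx.1.2, fun hxZ ↦ hx.2 ((hΩK x hx.1).2 hxZ)⟩
    · exact fun hx ↦ ⟨⟨hx.1, hx.2.1⟩, fun hxK ↦ hx.2.2 ((hΩK x ⟨hx.1, hx.2.1⟩).1 hxK)⟩
  have hΩKo : IsOpen (Ω \ K) := by
    rw [hΩKeq]
    exact hcont.isOpen_inter_preimage hTo (hto.inter hZ.isOpen_compl)
  have hξat : ∀ x ∈ Ω \ K, ContMDiffAt I I.tangent 1
      (fun y ↦ (⟨y, ξ y⟩ : TangentBundle I M)) (φ x) := fun x hx ↦ by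
    rw [hΩKeq] at hx
    exact hξ.1.contMDiffAt (hZ.isOpen_compl.mem_nhds hx.2.2)
  have hdiffh : ∀ x ∈ T, DifferentiableAt ℝ h x := fun x hx ↦
    (hh2.contDiffAt (hTo.mem_nhds hx)).differentiableAt two_ne_zero
  have hLie : ∀ x ∈ Ω \ K, ∀ v w, flatLieDeriv h (chartField I c ξ) x v w = 0 := fun x hx ↦
    (forall_lieDerivMetric_eq_zero_iff hh hx.1.1 (hdiffh x hx.1.1) (hξat x hx)).1
      (hξ.2 _ (by rw [hΩKeq] at hx; exact hx.2.2))
  obtain ⟨B, hBo, hcB, hBΩ, g, hg, hgf, hgLie⟩ := exists_flat_killing_extension hΩ hcΩ hKdim hΩKo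
    (hh2.mono inter_subset_left) (fun x _ v w ↦ by rw [hh, hh, real_inner_comm])
    (fun x hx v hv ↦ by
      rw [hh]
      refine real_inner_self_pos.2 fun h0 ↦ hv (chartSymmDeriv_injective (I := I) hx.1 ?_)
      rw [h0, map_zero])
    (fun x hx ↦ (contDiffAt_chartField hx.1.1 (hξat x hx)).contDiffWithinAt) hLie
  have hU : IsOpen ((extChartAt I c).source ∩ extChartAt I c ⁻¹' B) :=
    (continuousOn_extChartAt c).isOpen_inter_preimage (isOpen_extChartAt_source c) hBo
  refine ⟨?_, _, hU, ⟨mem_extChartAt_source c, hcB⟩, ofChartField I c g, ⟨?_, ?_⟩, ?_⟩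
  -- Density of `Kᶜ` is carried back by the inverse chart: every `c` is a limit of points outside
  -- `Z`, which is what makes gluing unambiguous.
  · have hKd : Dense Kᶜ := dense_compl_of_dimH_lt_finrank (lt_of_le_of_lt le_self_add hKdim)
    have h1 := (continuousAt_extChartAt_symm (I := I) c).continuousWithinAt.mem_closure
      (mem_closure_inter_of_dense hΩ hKd hcΩ) (t := Zᶜ)
      fun x hx hxZ ↦ hx.2 ((hΩK x hx.1).2 hxZ)
    rwa [extChartAt_to_inv] at h1
  · exact fun y hy ↦ (contMDiffAt_ofChartField hy.1
      (hg.contDiffAt (hBo.mem_nhds hy.2))).contMDiffWithinAt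
  · intro y hy
    have hx : extChartAt I c y ∈ T := (extChartAt I c).map_source hy.1
    have hy' : φ (extChartAt I c y) = y := (extChartAt I c).left_inv hy.1
    have heq : chartField I c (ofChartField I c g) =ᶠ[𝓝 (extChartAt I c y)] g := by
      filter_upwards [hTo.mem_nhds hx] with z hz using chartField_ofChartField g hz
    have h1 := (forall_lieDerivMetric_eq_zero_iff hh hx (hdiffh _ hx)
      (ξ := ofChartField I c g) (by
        change ContMDiffAt _ _ _ _ (φ (extChartAt I c y))
        rw [hy']
        exact contMDiffAt_ofChartField hy.1 (hg.contDiffAt (hBo.mem_nhds hy.2)))).2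
      fun v w ↦ by
        have h2 := hgLie _ hy.2 v w
        simp only [flatLieDeriv, heq.fderiv_eq, heq.self_of_nhds] at h2 ⊢
        exact h2
    change ∀ V W : Π y : M, TangentSpace I y,
      ContMDiffAt I I.tangent 1 (fun y ↦ (⟨y, V y⟩ : TangentBundle I M)) (φ (extChartAt I c y)) →
      ContMDiffAt I I.tangent 1 (fun y ↦ (⟨y, W y⟩ : TangentBundle I M)) (φ (extChartAt I c y)) →
      lieDerivMetric I _ V W (φ (extChartAt I c y)) = 0 at h1
    rwa [hy'] at h1
  · intro y hy
    have hx : extChartAt I c y ∈ T := (extChartAt I c).map_source hy.1.1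
    have hy' : φ (extChartAt I c y) = y := (extChartAt I c).left_inv hy.1.1
    have hxK : extChartAt I c y ∈ B \ K :=
      ⟨hy.1.2, fun hK ↦ hy.2 (hy' ▸ (hΩK _ (hBΩ hy.1.2)).1 hK)⟩
    have h1 : ofChartField I c g (φ (extChartAt I c y)) = ξ (φ (extChartAt I c y)) := by
      rw [hφ, ofChartField_symm g hx, hgf hxK, chartSymmDeriv_chartField ξ hx]
    rwa [hy'] at h1

/-- Killing fields extend across closed sets of codimension larger than one. -/
theorem exists_killing_extension (hZ : IsClosed Z) (hdim : dimH Z + 1 < finrank ℝ E)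
    {ξ : Π x : M, TangentSpace I x} (hξ : IsKillingFieldOn I ξ Zᶜ) :
    ∃ ξ' : Π x : M, TangentSpace I x,
      (∀ x ∈ Zᶜ, ξ' x = ξ x) ∧ IsKillingFieldOn I ξ' univ := by
  choose hcl U hUo hU ζ hζ hζξ using exists_local_killing_extension hZ hdim hξ
  -- The global field is the diagonal `y ↦ ζ y y`. Near `y` both `ζ y` and `ζ c` equal `ξ` off `Z`,
  -- so they agree at `y` by continuity.
  have heq : ∀ c, ∀ y ∈ U c, ζ y y = ζ c y := fun c y hy ↦
    eq_of_eqOn_of_mem_closure (((hUo y).mem_nhds (hU y)) |> inter_mem ((hUo c).mem_nhds hy))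
      ((hζ y).1.contMDiffAt ((hUo y).mem_nhds (hU y)))
      ((hζ c).1.contMDiffAt ((hUo c).mem_nhds hy))
      (fun z hz ↦ by rw [hζξ y z ⟨hz.1.2, hz.2⟩, hζξ c z ⟨hz.1.1, hz.2⟩]) (hcl y)
  have hK : ∀ c, IsKillingFieldOn I (fun y ↦ ζ y y) (U c) := fun c ↦ (hζ c).congr (hUo c) (heq c)
  refine ⟨fun y ↦ ζ y y, fun x hx ↦ hζξ x x ⟨hU x, hx⟩, fun c _ ↦ ?_, fun c _ ↦ (hK c).2 c (hU c)⟩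
  exact ((hK c).1.contMDiffAt ((hUo c).mem_nhds (hU c))).contMDiffWithinAt

end Killing

theorem mainTheorem7 (n : ℕ)
    {X : Type*} [EMetricSpace X] [ChartedSpace (EuclideanSpace ℝ (Fin n)) X]
    [IsManifold (𝓡 n) 4 X] [IsManifold (𝓡 n) 1 X]
    [RiemannianBundle (fun x : X ↦ TangentSpace (𝓡 n) x)]
    [IsContMDiffRiemannianBundle (𝓡 n) 3 (EuclideanSpace ℝ (Fin n))
      (fun x : X ↦ TangentSpace (𝓡 n) x)]
    [IsRiemannianManifold (𝓡 n) X]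
    (Z : Set X) (hZ : IsClosed Z) (hdim : dimH Z + 1 < (n : ℝ≥0∞))
    (ξ : Π x : X, TangentSpace (𝓡 n) x) (hξ : IsKillingFieldOn (𝓡 n) ξ Zᶜ) :
    ∃ ξ' : Π x : X, TangentSpace (𝓡 n) x,
      (∀ x ∈ Zᶜ, ξ' x = ξ x) ∧ IsKillingFieldOn (𝓡 n) ξ' univ := by
  have : IsManifold (𝓡 n) 3 X := IsManifold.of_le (n := 4) (by norm_num)
  exact exists_killing_extension hZ (by simpa using hdim) hξ
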